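/- Let $\Gamma=\mathrm{SL}(2,\mathbb Z)$ act linearly on $\mathbb Z^2$. The Higson corona $\partial\mathbb Z^2$ is the compact Hausdorff space (Gelfand spectrum) determined by $$C(\partial\mathbb Z^2)=\{f\in\ell_\infty(\mathbb Z^2)\,:\,\forall a\in\mathbb Z^2,\ \lim_{x\to\infty}|f(x+a)-f(x)|=0\}\,/\,c_0(\mathbb Z^2),$$ equipped with the $\Gamma$-action by homeomorphisms induced by the linear action on $\mathbb Z^2$; that is, $(g\chi)([f])=\chi([f\circ g])$ for $g\in\Gamma$ and a character $\chi$ of $C(\partial\mathbb Z^2)$. Let $\mathcal P(\Gamma)=\{\mu\in\ell_1(\Gamma):\mu\ge 0,\ \|\mu\|_1=1\}$, with the norm topology and the left translation action $(g\mu)(h)=\mu(g^{-1}h)$. **Proposition.** The action of $\mathrm{SL}(2,\mathbb Z)$ on $\partial\mathbb Z^2$ is (topologically) amenable: there is a sequence of continuous maps $\mu_n\colon\partial\mathbb Z^2\to\mathcal P(\Gamma)$ such that $$\forall g\in\Gamma,\qquad \lim_{n\to\infty}\ \sup_{x\in\partial\mathbb Z^2}\|\mu_n(gx)-g\mu_n(x)\|_1=0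 .$$ -/

import Mathlib

open Filter Topology
open scoped MatrixGroups BoundedContinuousFunction ENNReal

noncomputable section

/-! ### Probability measures on a discrete group, amenable actions -/

/-- The space `𝒫(Γ) = {μ ∈ ℓ₁(Γ) : μ ≥ 0, ‖μ‖ = 1}` of probability measures on a discrete group;
as a subtype of `ℓ₁(Γ)` it carries the `ℓ₁`-norm topology. -/
abbrev ProbSpace (Γ : Type*) : Type _ :=
  {μ : lp (fun _ : Γ => ℝ) 1 // (∀ h, 0 ≤ μ h) ∧ ‖μ‖ = 1}

/-- Left translation on `ℓ₁(Γ)`: `(g μ)(h) = μ (g⁻¹ h)`. -/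
def l1Translate {Γ : Type*} [Group Γ] (g : Γ) (μ : lp (fun _ : Γ => ℝ) 1) :
    lp (fun _ : Γ => ℝ) 1 :=
  ⟨fun h => μ (g⁻¹ * h), by
    have h1 := (memℓp_gen_iff (p := 1) (by simp)).1 (lp.memℓp μ)
    exact (memℓp_gen_iff (p := 1) (by simp)).2 ((Equiv.mulLeft g⁻¹).summable_iff.2 h1)⟩

theorem norm_l1Translate {Γ : Type*} [Group Γ] (g : Γ) (μ : lp (fun _ : Γ => ℝ) 1) :
    ‖l1Translate g μ‖ = ‖μ‖ := by
  rw [lp.norm_eq_tsum_rpow (by simp), lp.norm_eq_tsum_rpow (by simp)]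
  congr 1
  exact (Equiv.mulLeft g⁻¹).tsum_eq (fun h => ‖μ h‖ ^ (1 : ℝ≥0∞).toReal)

/-- The action of `Γ` on `𝒫(Γ)` by left translations, `(g μ)(h) = μ (g⁻¹ h)`. -/
instance ProbSpace.instMulAction {Γ : Type*} [Group Γ] : MulAction Γ (ProbSpace Γ) where
  smul g μ := ⟨l1Translate g μ.1, fun h => μ.2.1 (g⁻¹ * h), by
    rw [norm_l1Translate, μ.2.2]⟩
  one_smul μ := by
    refine Subtype.ext (lp.ext (funext fun h => ?_))
    change μ.1 (1⁻¹ * h) = μ.1 h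
    simp
  mul_smul g k μ := by
    refine Subtype.ext (lp.ext (funext fun h => ?_))
    change μ.1 ((g * k)⁻¹ * h) = μ.1 (k⁻¹ * (g⁻¹ * h))
    simp [mul_assoc]

/-- An action of a countable discrete group `Γ` by homeomorphisms on a compact space `X` is
(topologically) amenable if there are continuous maps `μ₀, μ₁, … : X → 𝒫(Γ)` with
`lim_n sup_{x ∈ X} ‖μ_n (g x) - g μ_n (x)‖₁ = 0` for every `g ∈ Γ`.
All the norms are at most `2`, so the supremum is a genuine one. -/
def IsAmenableAction (Γ X : Type*) [Group Γ] [Countable Γ] [TopologicalSpace X] [CompactSpace X]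
    [MulAction Γ X] [ContinuousConstSMul Γ X] : Prop :=
  ∃ μ : ℕ → X → ProbSpace Γ, (∀ n, Continuous (μ n)) ∧
    ∀ g : Γ, Tendsto
      (fun n => ⨆ x : X, ‖(μ n (g • x) : lp (fun _ : Γ => ℝ) 1) - (g • μ n x : ProbSpace Γ)‖)
      atTop (𝓝 0)

/-! ### The Higson corona of `ℤ²` -/

/-- `ℓ_∞(ℤ²)`: the bounded (automatically continuous, as `ℤ²` is discrete) complex functions
on `ℤ²`, with the supremum norm. -/
abbrev LInftyZ2 : Type := (Fin 2 → ℤ) →ᵇ ℂ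

theorem isClosed_vanishing : IsClosed {f : LInftyZ2 | Tendsto f cofinite (𝓝 0)} := by
  refine isClosed_of_closure_subset fun f hf => ?_
  rw [Metric.mem_closure_iff] at hf
  rw [Set.mem_ofPred_eq, Metric.tendsto_nhds]
  intro ε hε
  obtain ⟨g, hg, hfg⟩ := hf (ε / 2) (half_pos hε)
  have hg' : Tendsto g cofinite (𝓝 0) := hg
  filter_upwards [Metric.tendsto_nhds.1 hg' (ε / 2) (half_pos hε)] with x hx
  calc dist (f x) 0 ≤ dist (f x) (g x) + dist (g x) 0 := dist_triangle _ _ _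
    _ < ε / 2 + ε / 2 :=
        add_lt_add ((BoundedContinuousFunction.dist_coe_le_dist x).trans_lt hfg) hx
    _ = ε := add_halves ε

theorem tendsto_bounded_mul (f : LInftyZ2) {u : (Fin 2 → ℤ) → ℂ} (hu : Tendsto u cofinite (𝓝 0)) :
    Tendsto (fun x => f x * u x) cofinite (𝓝 0) := by
  have h1 : Tendsto (fun x => ‖f‖ * ‖u x‖) cofinite (𝓝 0) := by
    simpa using hu.norm.const_mul ‖f‖
  refine squeeze_zero_norm (fun x => ?_) h1
  rw [norm_mul]
  exact mul_le_mul_of_nonneg_right (f.norm_coe_le_norm x) (norm_nonneg _)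

/-- The algebra of slowly oscillating bounded functions on `ℤ²`, that is,
`{f ∈ ℓ_∞(ℤ²) : ∀ a ∈ ℤ², lim_{x → ∞} |f (x + a) - f x| = 0}`. -/
def slowlyOscillating : Subalgebra ℂ LInftyZ2 where
  carrier := {f | ∀ a : Fin 2 → ℤ, Tendsto (fun x => ‖f (x + a) - f x‖) cofinite (𝓝 0)}
  mul_mem' {f g} hf hg a := by
    have h1 := tendsto_zero_iff_norm_tendsto_zero.2 (hf a)
    have h2 := tendsto_bounded_mul f (tendsto_zero_iff_norm_tendsto_zero.2 (hg a))
    have h3 := tendsto_bounded_mul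
      (g.compContinuous ⟨fun x => x + a, continuous_of_discreteTopology⟩) h1
    refine tendsto_zero_iff_norm_tendsto_zero.1 ?_
    have h4 := h2.add h3
    rw [add_zero] at h4
    refine h4.congr fun x => ?_
    simp only [BoundedContinuousFunction.compContinuous_apply, ContinuousMap.coe_mk,
      BoundedContinuousFunction.coe_mul, Pi.mul_apply]
    ring
  add_mem' {f g} hf hg a := by
    have h1 := (tendsto_zero_iff_norm_tendsto_zero.2 (hf a)).add
      (tendsto_zero_iff_norm_tendsto_zero.2 (hg a))
    rw [add_zero] at h1
    refine tendsto_zero_iff_norm_tendsto_zero.1 (h1.congr fun x => ?_)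
    simp only [BoundedContinuousFunction.coe_add, Pi.add_apply]
    ring
  algebraMap_mem' c a := by
    simp [BoundedContinuousFunction.algebraMap_apply]

theorem mem_slowlyOscillating {f : LInftyZ2} : f ∈ slowlyOscillating ↔
    ∀ a : Fin 2 → ℤ, Tendsto (fun x => ‖f (x + a) - f x‖) cofinite (𝓝 0) := Iff.rfl

theorem isClosed_slowlyOscillating : IsClosed (slowlyOscillating : Set LInftyZ2) := by
  have h : (slowlyOscillating : Set LInftyZ2) = ⋂ a : Fin 2 → ℤ,
      (fun f : LInftyZ2 => f.compContinuous ⟨fun x => x + a, continuous_of_discreteTopology⟩ - f) ⁻¹'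
        {f : LInftyZ2 | Tendsto f cofinite (𝓝 0)} := by
    ext f
    simp only [SetLike.mem_coe, mem_slowlyOscillating, Set.mem_iInter, Set.mem_preimage,
      Set.mem_ofPred_eq]
    exact forall_congr' fun a => tendsto_zero_iff_norm_tendsto_zero.symm
  rw [h]
  exact isClosed_iInter fun a => isClosed_vanishing.preimage
    ((BoundedContinuousFunction.continuous_compContinuous _).sub continuous_id)

instance : CompleteSpace slowlyOscillating := isClosed_slowlyOscillating.completeSpace_coe

/-- The ideal `c₀(ℤ²)` of functions vanishing at infinity, inside the slowly oscillating functions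
(every function in `c₀(ℤ²)` is slowly oscillating). -/
def c0Ideal : Ideal slowlyOscillating where
  carrier := {f | Tendsto (f : LInftyZ2) cofinite (𝓝 0)}
  add_mem' {f g} hf hg := by
    have h := Tendsto.add (show Tendsto (f : LInftyZ2) cofinite (𝓝 0) from hf)
      (show Tendsto (g : LInftyZ2) cofinite (𝓝 0) from hg)
    rw [add_zero] at h
    exact h
  zero_mem' := by
    change Tendsto (fun _ => (0 : ℂ)) cofinite (𝓝 0)
    exact tendsto_const_nhds
  smul_mem' f g hg := tendsto_bounded_mul (f : LInftyZ2) hg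

theorem mem_c0Ideal {f : slowlyOscillating} :
    f ∈ c0Ideal ↔ Tendsto (f : LInftyZ2) cofinite (𝓝 0) := Iff.rfl

instance : IsClosed (c0Ideal : Set slowlyOscillating) :=
  isClosed_vanishing.preimage continuous_subtype_val

/-- The commutative Banach algebra `C(∂ℤ²)`: slowly oscillating bounded functions on `ℤ²` modulo
`c₀(ℤ²)`, with the quotient norm. -/
def HigsonAlgebra : Type := slowlyOscillating ⧸ c0Ideal

instance : NormedCommRing HigsonAlgebra := Ideal.Quotient.normedCommRing c0Ideal

instance : NormedAlgebra ℂ HigsonAlgebra := Ideal.Quotient.normedAlgebra c0Ideal ℂ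

instance : CompleteSpace HigsonAlgebra := Submodule.Quotient.completeSpace c0Ideal

/-- The quotient map `f ↦ [f]`. -/
def HigsonAlgebra.mk : slowlyOscillating →ₐ[ℂ] HigsonAlgebra := Ideal.Quotient.mkₐ ℂ c0Ideal

theorem HigsonAlgebra.mk_surjective : Function.Surjective HigsonAlgebra.mk :=
  Ideal.Quotient.mk_surjective

/-- The Higson corona `∂ℤ²`: the Gelfand spectrum of `HigsonAlgebra`, i.e. the space of its
characters with the weak-* topology. -/
abbrev HigsonCorona : Type := WeakDual.characterSpace ℂ HigsonAlgebra

/-! ### The action of `SL(2,ℤ)` -/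

/-- The linear action of `g ∈ SL(2,ℤ)` on (column vectors in) `ℤ²`. -/
def sl2Map (g : SL(2, ℤ)) (x : Fin 2 → ℤ) : Fin 2 → ℤ := (g : Matrix (Fin 2) (Fin 2) ℤ).mulVec x

theorem sl2Map_one (x : Fin 2 → ℤ) : sl2Map 1 x = x := by simp [sl2Map]

theorem sl2Map_mul (g h : SL(2, ℤ)) (x : Fin 2 → ℤ) :
    sl2Map (g * h) x = sl2Map g (sl2Map h x) := by
  simp only [sl2Map, Matrix.SpecialLinearGroup.coe_mul, Matrix.mulVec_mulVec]

theorem sl2Map_add (g : SL(2, ℤ)) (x y : Fin 2 → ℤ) :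
    sl2Map g (x + y) = sl2Map g x + sl2Map g y := by simp [sl2Map, Matrix.mulVec_add]

theorem tendsto_sl2Map (g : SL(2, ℤ)) : Tendsto (sl2Map g) cofinite cofinite := by
  refine Function.Injective.tendsto_cofinite (Function.LeftInverse.injective (g := sl2Map g⁻¹) ?_)
  intro x
  rw [← sl2Map_mul, inv_mul_cancel, sl2Map_one]

/-- The algebra endomorphism `f ↦ f ∘ g` of the slowly oscillating functions. -/
def slowlyOscillatingComp (g : SL(2, ℤ)) : slowlyOscillating →ₐ[ℂ] slowlyOscillating where
  toFun f := ⟨(f : LInftyZ2).compContinuous ⟨sl2Map g, continuous_of_discreteTopology⟩, fun a => by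
    have h := (f.2 (sl2Map g a)).comp (tendsto_sl2Map g)
    refine h.congr fun x => ?_
    simp [sl2Map_add]⟩
  map_one' := rfl
  map_mul' _ _ := rfl
  map_zero' := rfl
  map_add' _ _ := rfl
  commutes' _ := rfl

theorem slowlyOscillatingComp_apply (g : SL(2, ℤ)) (f : slowlyOscillating) (x : Fin 2 → ℤ) :
    (slowlyOscillatingComp g f : LInftyZ2) x = (f : LInftyZ2) (sl2Map g x) := rfl

/-- The algebra endomorphism `[f] ↦ [f ∘ g]` of `HigsonAlgebra`. -/
def higsonComp (g : SL(2, ℤ)) : HigsonAlgebra →ₐ[ℂ] HigsonAlgebra :=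
  Ideal.quotientMapₐ c0Ideal (slowlyOscillatingComp g)
    (fun f hf => (show Tendsto (f : LInftyZ2) cofinite (𝓝 0) from hf).comp (tendsto_sl2Map g))

theorem higsonComp_mk (g : SL(2, ℤ)) (f : slowlyOscillating) :
    higsonComp g (HigsonAlgebra.mk f) =
      HigsonAlgebra.mk (slowlyOscillatingComp g f) := rfl

theorem higsonComp_one (f : HigsonAlgebra) : higsonComp 1 f = f := by
  obtain ⟨f, rfl⟩ := HigsonAlgebra.mk_surjective f
  rw [higsonComp_mk]
  congr 1
  ext x
  rw [slowlyOscillatingComp_apply, sl2Map_one]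

theorem higsonComp_mul (g h : SL(2, ℤ)) (f : HigsonAlgebra) :
    higsonComp (g * h) f = higsonComp h (higsonComp g f) := by
  obtain ⟨f, rfl⟩ := HigsonAlgebra.mk_surjective f
  simp only [higsonComp_mk]
  congr 1
  ext x
  simp only [slowlyOscillatingComp_apply, sl2Map_mul]

/-- The action of `SL(2,ℤ)` on `∂ℤ²` induced by the linear action on `ℤ²`: on characters it is
`(g χ)([f]) = χ([f ∘ g])`, extending `x ↦ g x` under evaluation at points. -/
instance HigsonCorona.instSMul : SMul SL(2, ℤ) HigsonCorona where
  smul g χ := WeakDual.CharacterSpace.equivAlgHom.symm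
    ((WeakDual.CharacterSpace.equivAlgHom χ).comp (higsonComp g))

theorem HigsonCorona.smul_apply (g : SL(2, ℤ)) (χ : HigsonCorona) (f : HigsonAlgebra) :
    (g • χ) f = χ (higsonComp g f) :=
  congrFun (WeakDual.CharacterSpace.equivAlgHom_symm_coe (𝕜 := ℂ)
    ((WeakDual.CharacterSpace.equivAlgHom χ).comp (higsonComp g))) f

instance HigsonCorona.instMulAction : MulAction SL(2, ℤ) HigsonCorona where
  one_smul χ := WeakDual.CharacterSpace.ext fun f => by
    rw [HigsonCorona.smul_apply, higsonComp_one]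
  mul_smul g h χ := WeakDual.CharacterSpace.ext fun f => by
    rw [HigsonCorona.smul_apply, HigsonCorona.smul_apply, HigsonCorona.smul_apply, higsonComp_mul]

instance HigsonCorona.instContinuousConstSMul : ContinuousConstSMul SL(2, ℤ) HigsonCorona where
  continuous_const_smul g := by
    refine continuous_induced_rng.2 (WeakDual.continuous_of_continuous_eval fun f => ?_)
    have h : Continuous fun χ : HigsonCorona => χ (higsonComp g f) :=
      (WeakDual.eval_continuous (higsonComp g f)).comp continuous_subtype_val
    exact h.congr fun χ => (HigsonCorona.smul_apply g χ f).symm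

instance : Countable SL(2, ℤ) :=
  haveI : Countable (Matrix (Fin 2) (Fin 2) ℤ) := inferInstanceAs (Countable (Fin 2 → Fin 2 → ℤ))
  Subtype.countable

end

/-!
The radial projection `x ↦ x / ‖x‖` on `ℤ²` is slowly oscillating, so it extends to a continuous map
`HigsonCorona.direction` from the corona to the unit sphere of `ℝ²`. A character agrees on finitely
many functions with a limit along an ultrafilter (`HigsonCorona.exists_ultrafilter`), and therefore
the extension intertwines the action on the corona with the action of `SL(2,ℤ)` on rays. It remains
to see that `SL(2,ℤ)` acts amenably on the circle of rays.

There the reason is geometric. The kernel `‖γ⁻¹ X‖⁻⁶`, normalised over `γ ∈ SL(2,ℤ)`, is an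
equivariant map `orbitMeasure` from `GL(2,ℝ)` to probability measures, and it satisfies a Harnack
inequality: multiplying `X` on the right by a matrix close to `1` changes the measure little,
uniformly in `X` (`norm_orbitMeasure_mul_sub_le`). A direction `v` determines the geodesic ray
`t ↦ frame v t` towards the corresponding boundary point of the hyperbolic plane. The image of this
ray under `g` and the ray of `g v` have the same endpoint, hence they are asymptotic after a bounded
shift of time (`exists_norm_orbitMeasure_mapGL_mul_frame_sub_le`). Averaging `orbitMeasure` over
a long and late segment of the ray makes both the shift and the remaining distance negligible
(`norm_rayMeasure_sub_smul_le`), and the resulting measures depend continuously on `v`.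
-/

noncomputable section

open scoped Matrix.Norms.Operator
open Matrix.SpecialLinearGroup (mapGL)

/-! ### Characters of the Higson corona as limits along ultrafilters -/

/-- A slowly oscillating function that is bounded away from zero near infinity is invertible modulo
`c₀(ℤ²)`. -/
theorem isUnit_mk_of_eventually_le_norm (h : slowlyOscillating) {ε : ℝ} (hε : 0 < ε)
    (hh : ∀ᶠ x in cofinite, ε ≤ ‖(h : LInftyZ2) x‖) : IsUnit (HigsonAlgebra.mk h) := by
  classical
  let k : LInftyZ2 := BoundedContinuousFunction.ofNormedAddCommGroupDiscrete
    (fun x => if ε ≤ ‖(h : LInftyZ2) x‖ then ((h : LInftyZ2) x)⁻¹ else 0) ε⁻¹ fun x => by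
      split_ifs with hx
      · rw [norm_inv]
        exact inv_anti₀ hε hx
      · simpa using hε.le
  have hkx : ∀ x, ε ≤ ‖(h : LInftyZ2) x‖ → k x = ((h : LInftyZ2) x)⁻¹ := fun x hx => if_pos hx
  have hk : k ∈ slowlyOscillating := by
    intro a
    have h0 : Tendsto (fun x => ε⁻¹ * ε⁻¹ * ‖(h : LInftyZ2) (x + a) - (h : LInftyZ2) x‖)
        cofinite (𝓝 0) := by
      simpa using (h.2 a).const_mul (ε⁻¹ * ε⁻¹)
    refine squeeze_zero' (Eventually.of_forall fun x => norm_nonneg _) ?_ h0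
    have hsh : ∀ᶠ x in cofinite, ε ≤ ‖(h : LInftyZ2) (x + a)‖ :=
      (add_left_injective a).tendsto_cofinite.eventually hh
    filter_upwards [hh, hsh] with x hx hxa
    have hx0 : (h : LInftyZ2) x ≠ 0 := norm_pos_iff.1 (hε.trans_le hx)
    have hxa0 : (h : LInftyZ2) (x + a) ≠ 0 := norm_pos_iff.1 (hε.trans_le hxa)
    rw [hkx _ hx, hkx _ hxa, inv_sub_inv hxa0 hx0, norm_div, norm_mul, norm_sub_rev, div_eq_inv_mul,
      mul_inv]
    gcongr
  refine IsUnit.of_mul_eq_one (HigsonAlgebra.mk ⟨k, hk⟩) ?_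
  rw [← map_mul, ← map_one HigsonAlgebra.mk]
  refine (Ideal.Quotient.mk_eq_mk_iff_sub_mem _ _).2 (mem_c0Ideal.2 ?_)
  refine tendsto_const_nhds.congr' ?_
  filter_upwards [hh] with x hx
  have hx0 : (h : LInftyZ2) x ≠ 0 := norm_pos_iff.1 (hε.trans_le hx)
  change 0 = (h : LInftyZ2) x * k x - 1
  rw [hkx x hx, mul_inv_cancel₀ hx0, sub_self]

theorem star_mem_slowlyOscillating {f : LInftyZ2} (hf : f ∈ slowlyOscillating) :
    star f ∈ slowlyOscillating := by
  intro a
  refine (hf a).congr fun x => ?_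
  rw [BoundedContinuousFunction.star_apply, BoundedContinuousFunction.star_apply, ← star_sub,
    norm_star]

/-- On finitely many slowly oscillating functions `f i`, a character is evaluation at a point at
infinity: otherwise `∑ i, |f i - χ [f i]|²`, which `χ` annihilates, would be invertible modulo
`c₀(ℤ²)`. -/
theorem HigsonCorona.exists_ultrafilter {ι : Type*} [Fintype ι] (χ : HigsonCorona)
    (f : ι → slowlyOscillating) :
    ∃ U : Ultrafilter (Fin 2 → ℤ), (U : Filter (Fin 2 → ℤ)) ≤ cofinite ∧
      ∀ i, Tendsto (f i : LInftyZ2) U (𝓝 (χ (HigsonAlgebra.mk (f i)))) := by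
  have key : MapClusterPt (fun i => χ (HigsonAlgebra.mk (f i))) cofinite
      (fun x i => (f i : LInftyZ2) x) := by
    rw [Metric.nhds_basis_ball.mapClusterPt_iff_frequently]
    intro ε hε
    by_contra hcon
    rw [not_frequently] at hcon
    let c : ι → slowlyOscillating := fun i => f i - algebraMap ℂ _ (χ (HigsonAlgebra.mk (f i)))
    let h : slowlyOscillating :=
      ∑ i, ⟨star (c i : LInftyZ2), star_mem_slowlyOscillating (c i).2⟩ * c i
    have hχ : χ (HigsonAlgebra.mk h) = 0 := by
      have hc : ∀ i, χ (HigsonAlgebra.mk (c i)) = 0 := fun i => by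
        simp only [c, map_sub, AlgHom.commutes]
        change _ - WeakDual.CharacterSpace.equivAlgHom χ _ = _
        rw [AlgHom.commutes]
        simp
      simp only [h, map_sum, map_mul, hc, mul_zero, Finset.sum_const_zero]
    have hx : ∀ x, (h : LInftyZ2) x =
        ((∑ i, ‖(f i : LInftyZ2) x - χ (HigsonAlgebra.mk (f i))‖ ^ 2 : ℝ) : ℂ) := by
      intro x
      have : ∀ s : Finset ι, ((∑ i ∈ s,
          ⟨star (c i : LInftyZ2), star_mem_slowlyOscillating (c i).2⟩ * c i :
            slowlyOscillating) : LInftyZ2) x =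
          ((∑ i ∈ s, ‖(f i : LInftyZ2) x - χ (HigsonAlgebra.mk (f i))‖ ^ 2 : ℝ) : ℂ) := by
        classical
        intro s
        induction s using Finset.induction_on with
        | empty => simp
        | insert i s hi ih =>
          rw [Finset.sum_insert hi, Finset.sum_insert hi, Complex.ofReal_add, ← ih,
            Complex.ofReal_pow, ← Complex.conj_mul']
          rfl
      exact this Finset.univ
    have hu := isUnit_mk_of_eventually_le_norm h (pow_pos hε 2) (by
      filter_upwards [hcon] with x hxε
      rw [Metric.mem_ball, dist_pi_lt_iff hε] at hxε
      push Not at hxε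
      obtain ⟨i, hi⟩ := hxε
      have hn : 0 ≤ ∑ i, ‖(f i : LInftyZ2) x - χ (HigsonAlgebra.mk (f i))‖ ^ 2 :=
        Finset.sum_nonneg fun i _ => by positivity
      rw [hx, Complex.norm_of_nonneg hn]
      rw [dist_eq_norm] at hi
      exact (pow_le_pow_left₀ hε.le hi 2).trans
        (Finset.single_le_sum (f := fun i => ‖(f i : LInftyZ2) x - χ (HigsonAlgebra.mk (f i))‖ ^ 2)
          (fun i _ => by positivity) (Finset.mem_univ i)))
    exact (hu.map (WeakDual.CharacterSpace.equivAlgHom χ)).ne_zero hχ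
  obtain ⟨U, hU, hlim⟩ := mapClusterPt_iff_ultrafilter.1 key
  exact ⟨U, hU, fun i => (tendsto_pi_nhds.1 hlim) i⟩

/-! ### The direction map from the Higson corona to the plane -/

/-- The `i`-th coordinate of the radial projection `x ↦ x / ‖x‖` (sup norm), with value `0` at the
origin. It is slowly oscillating. -/
def directionCoord (i : Fin 2) : slowlyOscillating :=
  ⟨BoundedContinuousFunction.ofNormedAddCommGroupDiscrete
    (fun x => (((x i : ℝ) / ‖x‖ : ℝ) : ℂ)) 1 fun x => by
      rw [Complex.norm_real, norm_div, norm_norm]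
      refine div_le_one_of_le₀ ?_ (norm_nonneg _)
      exact norm_le_pi_norm x i, by
    intro a
    have hlim : Tendsto (fun x : Fin 2 → ℤ => 2 * ‖a‖ / ‖x‖) cofinite (𝓝 0) := by
      refine Tendsto.const_div_atTop ?_ _
      rw [← cocompact_eq_cofinite]
      exact tendsto_norm_cocompact_atTop
    refine squeeze_zero' (Eventually.of_forall fun x => norm_nonneg _) ?_ hlim
    have h1 : ∀ᶠ x : Fin 2 → ℤ in cofinite, x ≠ 0 := eventually_cofinite_ne 0
    have h2 : ∀ᶠ x : Fin 2 → ℤ in cofinite, x ≠ -a := eventually_cofinite_ne (-a)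
    filter_upwards [h1, h2] with x hx hxa
    have hx0 : 0 < ‖x‖ := norm_pos_iff.2 hx
    have hxa0 : 0 < ‖x + a‖ := norm_pos_iff.2 fun h => hxa (eq_neg_of_add_eq_zero_left h)
    change ‖((((x + a) i : ℤ) / ‖x + a‖ : ℝ) : ℂ) - ((x i / ‖x‖ : ℝ) : ℂ)‖ ≤ _
    rw [← Complex.ofReal_sub, Complex.norm_real]
    have e : (((x + a) i : ℤ) / ‖x + a‖ : ℝ) - x i / ‖x‖ =
        ((a i : ℝ) + ((x + a) i : ℤ) / ‖x + a‖ * (‖x‖ - ‖x + a‖)) / ‖x‖ := by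
      rw [Pi.add_apply]
      push_cast
      field_simp
      ring
    rw [e, norm_div, norm_norm]
    gcongr
    have b1 : ‖(a i : ℝ)‖ ≤ ‖a‖ := norm_le_pi_norm a i
    have b2 : ‖(((x + a) i : ℤ) : ℝ) / ‖x + a‖‖ ≤ 1 := by
      rw [norm_div, norm_norm]
      exact div_le_one_of_le₀ (norm_le_pi_norm (x + a) i) (norm_nonneg _)
    have b3 : ‖‖x‖ - ‖x + a‖‖ ≤ ‖a‖ := by
      refine (abs_norm_sub_norm_le x (x + a)).trans ?_
      simp
    calc _ ≤ ‖(a i : ℝ)‖ + ‖(((x + a) i : ℤ) : ℝ) / ‖x + a‖‖ * ‖‖x‖ - ‖x + a‖‖ := by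
          rw [← norm_mul]
          exact norm_add_le _ _
      _ ≤ ‖a‖ + 1 * ‖a‖ := by gcongr
      _ = 2 * ‖a‖ := by ring⟩

theorem directionCoord_apply (i : Fin 2) (x : Fin 2 → ℤ) :
    (directionCoord i : LInftyZ2) x = (((x i : ℝ) / ‖x‖ : ℝ) : ℂ) := rfl

/-- The continuous extension to the corona of the radial projection `x ↦ x / ‖x‖`. -/
def HigsonCorona.direction (χ : HigsonCorona) : Fin 2 → ℝ :=
  fun i => (χ (HigsonAlgebra.mk (directionCoord i))).re

theorem HigsonCorona.continuous_direction : Continuous HigsonCorona.direction :=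
  continuous_pi fun i => Complex.continuous_re.comp
    ((WeakDual.eval_continuous (HigsonAlgebra.mk (directionCoord i))).comp continuous_subtype_val)

/-- The linear action of `SL(2,ℤ)` on `ℝ²`. -/
abbrev sl2RealMap (g : SL(2, ℤ)) (v : Fin 2 → ℝ) : Fin 2 → ℝ :=
  ((g : Matrix (Fin 2) (Fin 2) ℤ).map (Int.cast : ℤ → ℝ)).mulVec v

theorem norm_intCast_pi (x : Fin 2 → ℤ) : ‖fun i => (x i : ℝ)‖ = ‖x‖ := by
  simp only [Pi.norm_def]
  rfl

theorem intCast_sl2Map (g : SL(2, ℤ)) (x : Fin 2 → ℤ) :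
    (fun i => (sl2Map g x i : ℝ)) = sl2RealMap g fun i => (x i : ℝ) := by
  ext i
  fin_cases i <;> simp [sl2Map, sl2RealMap, Matrix.mulVec, dotProduct, Fin.sum_univ_two]

theorem sl2RealMap_ne_zero (g : SL(2, ℤ)) {v : Fin 2 → ℝ} (hv : v ≠ 0) : sl2RealMap g v ≠ 0 := by
  intro h
  refine hv (Matrix.eq_zero_of_mulVec_eq_zero ?_ h)
  have hdet := g.det_coe
  rw [Matrix.det_fin_two] at hdet ⊢
  simp only [Matrix.map_apply]
  rw [← Int.cast_mul, ← Int.cast_mul, ← Int.cast_sub, hdet]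
  simp

/-- The direction map takes values in the unit sphere and intertwines the action on the corona with
the linear action on rays. -/
theorem HigsonCorona.norm_direction_and_direction_smul (g : SL(2, ℤ)) (χ : HigsonCorona) :
    ‖χ.direction‖ = 1 ∧
      (g • χ).direction = ‖sl2RealMap g χ.direction‖⁻¹ • sl2RealMap g χ.direction := by
  obtain ⟨U, hU, hlim⟩ := χ.exists_ultrafilter
    (Sum.elim directionCoord fun i => slowlyOscillatingComp g (directionCoord i))
  have h0 : Tendsto (fun x : Fin 2 → ℤ => ‖x‖⁻¹ • fun i => (x i : ℝ)) U (𝓝 χ.direction) := by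
    refine tendsto_pi_nhds.2 fun i => ?_
    refine ((Complex.continuous_re.tendsto _).comp (hlim (Sum.inl i))).congr fun x => ?_
    simp only [Sum.elim_inl, Function.comp_apply, directionCoord_apply, Complex.ofReal_re,
      Pi.smul_apply, smul_eq_mul, div_eq_inv_mul]
  have h1 : Tendsto (fun x : Fin 2 → ℤ => ‖sl2Map g x‖⁻¹ • fun i => (sl2Map g x i : ℝ)) U
      (𝓝 (g • χ).direction) := by
    refine tendsto_pi_nhds.2 fun i => ?_
    have h := (Complex.continuous_re.tendsto _).comp (hlim (Sum.inr i))
    simp only [Sum.elim_inr, ← higsonComp_mk, ← HigsonCorona.smul_apply] at h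
    refine h.congr fun x => ?_
    simp only [Function.comp_apply, slowlyOscillatingComp_apply, directionCoord_apply,
      Complex.ofReal_re, Pi.smul_apply, smul_eq_mul, div_eq_inv_mul]
  have hne : ∀ᶠ x : Fin 2 → ℤ in U, x ≠ 0 := hU (eventually_cofinite_ne 0)
  have hnorm : ‖χ.direction‖ = 1 := by
    refine tendsto_nhds_unique h0.norm (tendsto_const_nhds.congr' ?_)
    filter_upwards [hne] with x hx
    rw [norm_smul, norm_intCast_pi, norm_inv, norm_norm, inv_mul_cancel₀ (norm_ne_zero_iff.2 hx)]
  refine ⟨hnorm, tendsto_nhds_unique h1 ?_⟩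
  -- the projection of `g x` is the projection of `g (x / ‖x‖)`, which is continuous in `x / ‖x‖`
  have hcont : Continuous (sl2RealMap g) := by fun_prop
  have hD : sl2RealMap g χ.direction ≠ 0 :=
    sl2RealMap_ne_zero g (norm_ne_zero_iff.1 (hnorm ▸ one_ne_zero))
  have h2 := (hcont.tendsto _).comp h0
  refine ((h2.norm.inv₀ (norm_ne_zero_iff.2 hD)).smul h2).congr' ?_
  filter_upwards [hne] with x hx
  have hx0 : ‖x‖ ≠ 0 := norm_ne_zero_iff.2 hx
  simp only [Function.comp_apply, sl2RealMap, Matrix.mulVec_smul]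
  rw [← sl2RealMap, ← intCast_sl2Map, norm_smul, norm_intCast_pi, norm_inv, norm_norm, mul_inv,
    inv_inv, smul_smul]
  congr 1
  field_simp

theorem HigsonCorona.direction_ne_zero (χ : HigsonCorona) : χ.direction ≠ 0 :=
  norm_ne_zero_iff.1 ((HigsonCorona.norm_direction_and_direction_smul 1 χ).1 ▸ one_ne_zero)

/-! ### An equivariant map from `GL(2,ℝ)` to probability measures -/

/-- The unnormalised kernel `γ ↦ ‖γ⁻¹ X‖⁻⁶`, with the operator norm on `ℓ_∞²`. -/
def orbitWeight (X : GL (Fin 2) ℝ) (γ : SL(2, ℤ)) : ℝ :=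
  (‖(((mapGL ℝ γ)⁻¹ * X : GL (Fin 2) ℝ) : Matrix (Fin 2) (Fin 2) ℝ)‖ ^ 6)⁻¹

theorem norm_coe_GL_pos (Y : GL (Fin 2) ℝ) : 0 < ‖(Y : Matrix (Fin 2) (Fin 2) ℝ)‖ :=
  norm_pos_iff.2 Y.ne_zero

theorem orbitWeight_pos (X : GL (Fin 2) ℝ) (γ : SL(2, ℤ)) : 0 < orbitWeight X γ :=
  inv_pos.2 (pow_pos (norm_coe_GL_pos _) 6)

theorem orbitWeight_mapGL_mul (g : SL(2, ℤ)) (X : GL (Fin 2) ℝ) (γ : SL(2, ℤ)) :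
    orbitWeight (mapGL ℝ g * X) γ = orbitWeight X (g⁻¹ * γ) := by
  simp only [orbitWeight, map_mul, map_inv, mul_inv_rev, inv_inv, mul_assoc]

/-- A Harnack inequality: right multiplication changes the kernel by a bounded factor. -/
theorem orbitWeight_mul_le (X P : GL (Fin 2) ℝ) (γ : SL(2, ℤ)) {K : ℝ}
    (hP : ‖((P⁻¹ : GL (Fin 2) ℝ) : Matrix (Fin 2) (Fin 2) ℝ)‖ ≤ K) :
    orbitWeight (X * P) γ ≤ K ^ 6 * orbitWeight X γ := by
  simp only [orbitWeight, ← mul_assoc]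
  set Y := (mapGL ℝ γ)⁻¹ * X
  have hK : 0 < K := (norm_coe_GL_pos _).trans_le hP
  have h : ‖(Y : Matrix (Fin 2) (Fin 2) ℝ)‖ ≤
      ‖((Y * P : GL (Fin 2) ℝ) : Matrix (Fin 2) (Fin 2) ℝ)‖ * K := by
    calc ‖(Y : Matrix (Fin 2) (Fin 2) ℝ)‖
        = ‖((Y * P : GL (Fin 2) ℝ) : Matrix (Fin 2) (Fin 2) ℝ) *
            ((P⁻¹ : GL (Fin 2) ℝ) : Matrix (Fin 2) (Fin 2) ℝ)‖ := by
          rw [← Units.val_mul, mul_inv_cancel_right]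
      _ ≤ _ := (norm_mul_le _ _).trans (by gcongr)
  rw [← div_eq_mul_inv, inv_le_comm₀ (pow_pos (norm_coe_GL_pos _) 6)
    (div_pos (pow_pos hK 6) (pow_pos (norm_coe_GL_pos _) 6)), inv_div,
    div_le_iff₀ (pow_pos hK 6), ← mul_pow]
  exact pow_le_pow_left₀ (norm_nonneg _) h 6

theorem norm_row_le (γ : SL(2, ℤ)) (i : Fin 2) :
    ‖γ.1 i‖ ≤ ‖((mapGL ℝ γ : GL (Fin 2) ℝ) : Matrix (Fin 2) (Fin 2) ℝ)‖ := by
  refine (pi_norm_le_iff_of_nonneg (norm_nonneg _)).2 fun j => ?_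
  have h := Matrix.linfty_opNorm_mulVec
    ((mapGL ℝ γ : GL (Fin 2) ℝ) : Matrix (Fin 2) (Fin 2) ℝ) (Pi.single j 1)
  have h1 : ‖(Pi.single j 1 : Fin 2 → ℝ)‖ = 1 := by rw [Pi.norm_single, norm_one]
  rw [h1, mul_one] at h
  refine le_trans ?_ ((norm_le_pi_norm _ i).trans h)
  rw [Matrix.mulVec_single_one]
  simp [Matrix.col, Int.norm_eq_abs]

/-- The norm of an integer matrix bounds the norms of both rows, so the sum of the `‖γ‖⁻⁶` is at
most the square of the sum of the `‖x‖⁻³` over `ℤ²`. -/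
theorem summable_orbitWeight_one : Summable (orbitWeight 1) := by
  have hs : Summable fun x : Fin 2 → ℤ => (‖x‖ ^ 3)⁻¹ := by
    refine (EisensteinSeries.summable_one_div_norm_rpow (k := 3) (by norm_num)).congr fun x => ?_
    rw [Real.rpow_neg (norm_nonneg _)]
    norm_cast
  have hs2 := hs.mul_of_nonneg hs (fun x => by positivity) (fun x => by positivity)
  let rows : SL(2, ℤ) → (Fin 2 → ℤ) × (Fin 2 → ℤ) := fun γ => (γ.1 0, γ.1 1)
  have hinj : Function.Injective rows := by
    intro γ δ h
    have h0 := congrArg Prod.fst h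
    have h1 := congrArg Prod.snd h
    refine Subtype.ext (funext fun i => ?_)
    fin_cases i
    · exact h0
    · exact h1
  rw [← (Equiv.inv SL(2, ℤ)).summable_iff]
  refine (hs2.comp_injective hinj).of_nonneg_of_le (fun γ => (orbitWeight_pos 1 _).le) fun γ => ?_
  have hrow : ∀ i, 0 < ‖γ.1 i‖ := fun i =>
    norm_pos_iff.2 (Matrix.SpecialLinearGroup.row_ne_zero γ i)
  simp only [Function.comp_apply, Equiv.inv_apply, orbitWeight, mul_one, map_inv, inv_inv, rows]
  rw [← mul_inv]
  refine inv_anti₀ (mul_pos (pow_pos (hrow 0) 3) (pow_pos (hrow 1) 3)) ?_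
  rw [show (6 : ℕ) = 3 + 3 from rfl, pow_add]
  gcongr <;> exact norm_row_le γ _

theorem summable_orbitWeight (X : GL (Fin 2) ℝ) : Summable (orbitWeight X) :=
  (summable_orbitWeight_one.mul_left _).of_nonneg_of_le (fun γ => (orbitWeight_pos X γ).le)
    fun γ => by simpa only [one_mul] using orbitWeight_mul_le 1 X γ le_rfl

theorem tsum_orbitWeight_pos (X : GL (Fin 2) ℝ) : 0 < ∑' γ, orbitWeight X γ :=
  (summable_orbitWeight X).tsum_pos (fun γ => (orbitWeight_pos X γ).le) 1 (orbitWeight_pos X 1)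

theorem norm_lp_one {ι : Type*} (f : lp (fun _ : ι => ℝ) 1) : ‖f‖ = ∑' i, |f i| := by
  rw [lp.norm_eq_tsum_rpow (by simp)]
  simp

theorem summable_abs_lp_one {ι : Type*} (f : lp (fun _ : ι => ℝ) 1) : Summable fun i => |f i| := by
  simpa using (memℓp_gen_iff (p := 1) (by simp)).1 (lp.memℓp f)

/-- The probability measure on `SL(2,ℤ)` proportional to `γ ↦ ‖γ⁻¹ X‖⁻⁶`. -/
def orbitMeasure (X : GL (Fin 2) ℝ) : ProbSpace SL(2, ℤ) :=
  ⟨⟨fun γ => orbitWeight X γ / ∑' δ, orbitWeight X δ, by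
      refine (memℓp_gen_iff (p := 1) (by simp)).2 ?_
      simpa [abs_div] using ((summable_orbitWeight X).div_const (∑' δ, orbitWeight X δ)).abs⟩,
    fun γ => div_nonneg (orbitWeight_pos X γ).le (tsum_orbitWeight_pos X).le, by
    rw [norm_lp_one]
    refine (tsum_congr fun γ => abs_of_pos
      (div_pos (orbitWeight_pos X γ) (tsum_orbitWeight_pos X))).trans ?_
    rw [tsum_div_const, div_self (tsum_orbitWeight_pos X).ne']⟩

theorem orbitMeasure_apply (X : GL (Fin 2) ℝ) (γ : SL(2, ℤ)) :
    (orbitMeasure X).1 γ = orbitWeight X γ / ∑' δ, orbitWeight X δ := rfl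

theorem smul_orbitMeasure (g : SL(2, ℤ)) (X : GL (Fin 2) ℝ) :
    g • orbitMeasure X = orbitMeasure (mapGL ℝ g * X) := by
  refine Subtype.ext (lp.ext (funext fun γ => ?_))
  change (orbitMeasure X).1 (g⁻¹ * γ) = _
  simp only [orbitMeasure_apply, orbitWeight_mapGL_mul]
  rw [← (Equiv.mulLeft g⁻¹).tsum_eq (orbitWeight X)]
  rfl

/-- Two probability measures whose densities agree up to a factor `L` are at distance at most
`L - 1`. -/
theorem ProbSpace.norm_sub_le {Γ : Type*} (μ ν : ProbSpace Γ) {L : ℝ}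
    (h1 : ∀ γ, μ.1 γ ≤ L * ν.1 γ) (h2 : ∀ γ, ν.1 γ ≤ L * μ.1 γ) : ‖μ.1 - ν.1‖ ≤ L - 1 := by
  have hν : ∑' γ, ν.1 γ = 1 := by
    refine Eq.trans ?_ ((norm_lp_one ν.1).symm.trans ν.2.2)
    exact tsum_congr fun γ => (abs_of_nonneg (ν.2.1 γ)).symm
  have hsν : Summable fun γ => ν.1 γ :=
    (summable_abs_lp_one ν.1).congr fun γ => abs_of_nonneg (ν.2.1 γ)
  rw [norm_lp_one]
  calc ∑' γ, |(μ.1 - ν.1) γ| ≤ ∑' γ, (L - 1) * ν.1 γ := by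
        refine (summable_abs_lp_one _).tsum_le_tsum (fun γ => ?_) (hsν.mul_left _)
        rw [lp.coeFn_sub, Pi.sub_apply, abs_le]
        have hμ0 := μ.2.1 γ
        have hν0 := ν.2.1 γ
        have := h1 γ
        have := h2 γ
        constructor
        · rcases le_total L 1 with hL | hL
          · nlinarith
          · nlinarith
        · linarith
    _ = L - 1 := by rw [tsum_mul_left, hν, mul_one]

theorem orbitMeasure_mul_apply_le (X P : GL (Fin 2) ℝ) (γ : SL(2, ℤ)) {K : ℝ}
    (h1 : ‖(P : Matrix (Fin 2) (Fin 2) ℝ)‖ ≤ K)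
    (h2 : ‖((P⁻¹ : GL (Fin 2) ℝ) : Matrix (Fin 2) (Fin 2) ℝ)‖ ≤ K) :
    (orbitMeasure (X * P)).1 γ ≤ K ^ 12 * (orbitMeasure X).1 γ := by
  have hK : 0 < K := (norm_coe_GL_pos _).trans_le h1
  have hsum : ∑' δ, orbitWeight X δ ≤ K ^ 6 * ∑' δ, orbitWeight (X * P) δ := by
    rw [← tsum_mul_left]
    refine (summable_orbitWeight X).tsum_le_tsum (fun δ => ?_)
      ((summable_orbitWeight (X * P)).mul_left _)
    have h := orbitWeight_mul_le (X * P) P⁻¹ δ (K := K) (by rwa [inv_inv])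
    rwa [mul_inv_cancel_right] at h
  have hpos := tsum_orbitWeight_pos X
  have hpos' := tsum_orbitWeight_pos (X * P)
  have hw := orbitWeight_mul_le X P γ h2
  have hw0 := (orbitWeight_pos X γ).le
  rw [orbitMeasure_apply, orbitMeasure_apply]
  generalize (∑' δ, orbitWeight X δ) = S at *
  generalize (∑' δ, orbitWeight (X * P) δ) = S' at *
  rw [div_le_iff₀ hpos']
  have hwS : 0 ≤ orbitWeight X γ / S := div_nonneg hw0 hpos.le
  calc orbitWeight (X * P) γ ≤ K ^ 6 * orbitWeight X γ := hw
    _ = K ^ 6 * (orbitWeight X γ / S) * S := by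
        rw [mul_assoc, div_mul_cancel₀ _ hpos.ne']
    _ ≤ K ^ 6 * (orbitWeight X γ / S) * (K ^ 6 * S') := by gcongr
    _ = K ^ 12 * (orbitWeight X γ / S) * S' := by ring

/-- The measure `orbitMeasure X` is uniformly continuous with respect to right multiplication. -/
theorem norm_orbitMeasure_mul_sub_le (X P : GL (Fin 2) ℝ) {K : ℝ}
    (h1 : ‖(P : Matrix (Fin 2) (Fin 2) ℝ)‖ ≤ K)
    (h2 : ‖((P⁻¹ : GL (Fin 2) ℝ) : Matrix (Fin 2) (Fin 2) ℝ)‖ ≤ K) :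
    ‖(orbitMeasure (X * P)).1 - (orbitMeasure X).1‖ ≤ K ^ 12 - 1 := by
  refine ProbSpace.norm_sub_le _ _ (fun γ => orbitMeasure_mul_apply_le X P γ h1 h2) fun γ => ?_
  have h := orbitMeasure_mul_apply_le (X * P) P⁻¹ γ h2 (by rwa [inv_inv])
  rwa [mul_inv_cancel_right] at h

theorem continuous_orbitMeasure : Continuous orbitMeasure := by
  refine continuous_induced_rng.2 (continuous_iff_continuousAt.2 fun X => ?_)
  refine tendsto_iff_norm_sub_tendsto_zero.2 ?_
  have hK : Tendsto (fun Y : GL (Fin 2) ℝ =>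
      max ‖((X⁻¹ * Y : GL (Fin 2) ℝ) : Matrix (Fin 2) (Fin 2) ℝ)‖
        ‖(((X⁻¹ * Y)⁻¹ : GL (Fin 2) ℝ) : Matrix (Fin 2) (Fin 2) ℝ)‖ ^ 12 - 1) (𝓝 X) (𝓝 0) := by
    have hc : Continuous fun Y : GL (Fin 2) ℝ =>
        max ‖((X⁻¹ * Y : GL (Fin 2) ℝ) : Matrix (Fin 2) (Fin 2) ℝ)‖
          ‖(((X⁻¹ * Y)⁻¹ : GL (Fin 2) ℝ) : Matrix (Fin 2) (Fin 2) ℝ)‖ ^ 12 - 1 := by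
      have h1 : Continuous fun Y : GL (Fin 2) ℝ => X⁻¹ * Y := continuous_const_mul _
      have h2 := Units.continuous_val.comp h1
      have h3 := Units.continuous_val.comp h1.inv
      exact ((h2.norm.max h3.norm).pow 12).sub continuous_const
    have h := hc.tendsto X
    simpa using h
  refine squeeze_zero (fun Y => norm_nonneg _) (fun Y => ?_) hK
  have h := norm_orbitMeasure_mul_sub_le X (X⁻¹ * Y) (le_max_left _ _) (le_max_right _ _)
  rwa [mul_inv_cancel_left] at h

/-- The normalisation makes `orbitMeasure` invariant under scalars. -/
theorem orbitMeasure_eq_of_coe_eq_smul {X Y : GL (Fin 2) ℝ} {c : ℝ} (hc : c ≠ 0)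
    (h : (Y : Matrix (Fin 2) (Fin 2) ℝ) = c • (X : Matrix (Fin 2) (Fin 2) ℝ)) :
    orbitMeasure Y = orbitMeasure X := by
  have hw : ∀ γ, orbitWeight Y γ = (|c| ^ 6)⁻¹ * orbitWeight X γ := fun γ => by
    simp only [orbitWeight, Units.val_mul, h, mul_smul_comm, norm_smul, Real.norm_eq_abs, mul_pow,
      mul_inv]
  refine Subtype.ext (lp.ext (funext fun γ => ?_))
  simp only [orbitMeasure_apply, hw, tsum_mul_left]
  rw [mul_div_mul_left]
  exact inv_ne_zero (pow_ne_zero 6 (abs_ne_zero.2 hc))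

/-! ### Frames along a direction -/

theorem sq_add_sq_pos {v : Fin 2 → ℝ} (hv : v ≠ 0) : 0 < v 0 ^ 2 + v 1 ^ 2 := by
  by_contra h
  refine hv (funext fun i => ?_)
  fin_cases i
  · change v 0 = 0
    nlinarith
  · change v 1 = 0
    nlinarith

/-- The matrix with columns `v` and `e⁻ᵗ v^⊥`, where `v^⊥` is `v` rotated by a right angle. Modulo
scalars and rotations these are the points of the geodesic ray in the hyperbolic plane that points
in the direction of `v`. -/
def frame (v : Fin 2 → ℝ) (hv : v ≠ 0) (t : ℝ) : GL (Fin 2) ℝ :=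
  Matrix.GeneralLinearGroup.mkOfDetNeZero
    !![v 0, -(Real.exp (-t) * v 1); v 1, Real.exp (-t) * v 0] (by
      rw [Matrix.det_fin_two_of]
      have := mul_pos (Real.exp_pos (-t)) (sq_add_sq_pos hv)
      nlinarith)

theorem coe_frame (v : Fin 2 → ℝ) (hv : v ≠ 0) (t : ℝ) :
    (frame v hv t : Matrix (Fin 2) (Fin 2) ℝ) =
      !![v 0, -(Real.exp (-t) * v 1); v 1, Real.exp (-t) * v 0] := rfl

theorem continuous_frame {X : Type*} [TopologicalSpace X] {v : X → Fin 2 → ℝ} (hc : Continuous v)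
    (hv : ∀ x, v x ≠ 0) (t : ℝ) : Continuous fun x => frame (v x) (hv x) t := by
  refine (Units.isOpenEmbedding_val
    (R := Matrix (Fin 2) (Fin 2) ℝ)).isEmbedding.continuous_iff.2 ?_
  refine continuous_matrix fun i j => ?_
  fin_cases i <;> fin_cases j <;> simp [coe_frame] <;> fun_prop

theorem orbitMeasure_frame_smul (v : Fin 2 → ℝ) (hv : v ≠ 0) {c : ℝ} (hc : c ≠ 0)
    (hcv : c • v ≠ 0) (t : ℝ) :
    orbitMeasure (frame (c • v) hcv t) = orbitMeasure (frame v hv t) := by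
  refine orbitMeasure_eq_of_coe_eq_smul hc ?_
  rw [coe_frame, coe_frame]
  ext i j
  fin_cases i <;> fin_cases j <;> simp <;> ring

theorem norm_matrix_fin_two_le {A : Matrix (Fin 2) (Fin 2) ℝ} {r : ℝ}
    (h0 : |A 0 0| + |A 0 1| ≤ r) (h1 : |A 1 0| + |A 1 1| ≤ r) : ‖A‖ ≤ r := by
  have hr : 0 ≤ r := (add_nonneg (abs_nonneg _) (abs_nonneg _)).trans h0
  lift r to NNReal using hr
  rw [Matrix.linfty_opNorm_def, NNReal.coe_le_coe]
  refine Finset.sup_le fun i _ => ?_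
  rw [← NNReal.coe_le_coe, Fin.sum_univ_two]
  fin_cases i
  · simpa using h0
  · simpa using h1

/-- The measures vary slowly along a ray. -/
theorem norm_orbitMeasure_frame_add_sub_le (v : Fin 2 → ℝ) (hv : v ≠ 0) (t s : ℝ) (hs : 0 ≤ s) :
    ‖(orbitMeasure (frame v hv (t + s))).1 - (orbitMeasure (frame v hv t)).1‖ ≤
      Real.exp s ^ 12 - 1 := by
  have hmul : Real.exp (-s) * Real.exp s = 1 := by rw [← Real.exp_add]; simp
  let P : GL (Fin 2) ℝ := ⟨!![1, 0; 0, Real.exp (-s)], !![1, 0; 0, Real.exp s],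
    by simp [Matrix.one_fin_two, hmul], by simp [Matrix.one_fin_two, mul_comm (Real.exp s), hmul]⟩
  have hPinv : ((P⁻¹ : GL (Fin 2) ℝ) : Matrix (Fin 2) (Fin 2) ℝ) = !![1, 0; 0, Real.exp s] := rfl
  have hP : frame v hv (t + s) = frame v hv t * P := by
    refine Units.ext ?_
    rw [Units.val_mul, coe_frame, coe_frame, neg_add, Real.exp_add]
    ext i j
    fin_cases i <;> fin_cases j <;> simp [P] <;> ring
  have h1 : 1 ≤ Real.exp s := Real.one_le_exp hs
  have h2 : Real.exp (-s) ≤ Real.exp s := Real.exp_le_exp.2 (by linarith)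
  rw [hP]
  refine norm_orbitMeasure_mul_sub_le _ _ (norm_matrix_fin_two_le ?_ ?_)
    (norm_matrix_fin_two_le ?_ ?_)
  · simpa [P] using h1
  · simpa [P] using h2
  · simpa [hPinv] using h1
  · simp [hPinv]

/-- The squared Hilbert-Schmidt norm of a matrix in `SL(2,ℤ)`. -/
def hsNormSq (g : SL(2, ℤ)) : ℝ :=
  (g.1 0 0 : ℝ) ^ 2 + (g.1 0 1 : ℝ) ^ 2 + (g.1 1 0 : ℝ) ^ 2 + (g.1 1 1 : ℝ) ^ 2

/-- The shear with off-diagonal entry `x`. -/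
def shear (x : ℝ) : GL (Fin 2) ℝ :=
  ⟨!![1, x; 0, 1], !![1, -x; 0, 1], by simp [Matrix.one_fin_two], by simp [Matrix.one_fin_two]⟩

theorem norm_orbitMeasure_mul_shear_sub_le (X : GL (Fin 2) ℝ) {x r : ℝ} (hx : |x| ≤ r) :
    ‖(orbitMeasure (X * shear x)).1 - (orbitMeasure X).1‖ ≤ (1 + r) ^ 12 - 1 := by
  have hr : 0 ≤ r := (abs_nonneg x).trans hx
  have h1 : ((shear x : GL (Fin 2) ℝ) : Matrix (Fin 2) (Fin 2) ℝ) = !![1, x; 0, 1] := rfl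
  have h2 : (((shear x)⁻¹ : GL (Fin 2) ℝ) : Matrix (Fin 2) (Fin 2) ℝ) = !![1, -x; 0, 1] := rfl
  refine norm_orbitMeasure_mul_sub_le _ _ (norm_matrix_fin_two_le ?_ ?_)
    (norm_matrix_fin_two_le ?_ ?_)
  · simpa [h1] using hx
  · simpa [h1] using hr
  · simpa [h2] using hx
  · simpa [h2] using hr

/-- A matrix `g ∈ SL(2,ℤ)` maps the ray in direction `v` to a ray asymptotic to the one in direction
`g v`: the time parameters differ by a bounded shift `τ`, and the distance decays like `e⁻ᵗ`. -/
theorem exists_norm_orbitMeasure_mapGL_mul_frame_sub_le (g : SL(2, ℤ)) (v : Fin 2 → ℝ) (hv : v ≠ 0)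
    (hgv : sl2RealMap g v ≠ 0) : ∃ τ : ℝ, |τ| ≤ Real.log (hsNormSq g) ∧ ∀ t,
      ‖(orbitMeasure (mapGL ℝ g * frame v hv t)).1 -
        (orbitMeasure (frame (sl2RealMap g v) hgv (t + τ))).1‖ ≤
          (1 + Real.exp (-t) * hsNormSq g) ^ 12 - 1 := by
  have hdet : (g.1 0 0 : ℝ) * g.1 1 1 - g.1 0 1 * g.1 1 0 = 1 := by
    have h := g.2
    rw [Matrix.det_fin_two] at h
    exact_mod_cast h
  have hw0 : sl2RealMap g v 0 = g.1 0 0 * v 0 + g.1 0 1 * v 1 := by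
    simp [sl2RealMap, Matrix.mulVec, dotProduct, Fin.sum_univ_two]
  have hw1 : sl2RealMap g v 1 = g.1 1 0 * v 0 + g.1 1 1 * v 1 := by
    simp [sl2RealMap, Matrix.mulVec, dotProduct, Fin.sum_univ_two]
  have hval : ((mapGL ℝ g : GL (Fin 2) ℝ) : Matrix (Fin 2) (Fin 2) ℝ) =
      !![(g.1 0 0 : ℝ), g.1 0 1; g.1 1 0, g.1 1 1] := by
    ext i j
    fin_cases i <;> fin_cases j <;> simp
  have hpv := sq_add_sq_pos hv
  have hpw := sq_add_sq_pos hgv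
  unfold hsNormSq
  generalize sl2RealMap g v = w at *
  generalize (g.1 0 0 : ℝ) = a at *
  generalize (g.1 0 1 : ℝ) = b at *
  generalize (g.1 1 0 : ℝ) = c at *
  generalize (g.1 1 1 : ℝ) = d at *
  set S := a ^ 2 + b ^ 2 + c ^ 2 + d ^ 2 with hS
  have hS0 : 0 < S := by nlinarith [sq_nonneg (a - d), sq_nonneg (b + c)]
  set p := v 0 ^ 2 + v 1 ^ 2 with hp
  set q := w 0 ^ 2 + w 1 ^ 2 with hq
  have hv0 : v 0 = d * w 0 - b * w 1 := by rw [hw0, hw1]; linear_combination (-v 0) * hdet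
  have hv1 : v 1 = a * w 1 - c * w 0 := by rw [hw0, hw1]; linear_combination (-v 1) * hdet
  -- `g` and `g⁻¹` have the same Hilbert-Schmidt norm, so both bounds below are Cauchy-Schwarz
  have hqp : q ≤ S * p := by
    have : S * p - q = (a * v 1 - b * v 0) ^ 2 + (c * v 1 - d * v 0) ^ 2 := by
      rw [hq, hw0, hw1, hS, hp]; ring
    nlinarith [sq_nonneg (a * v 1 - b * v 0), sq_nonneg (c * v 1 - d * v 0)]
  have hpq : p ≤ S * q := by
    have : S * q - p = (d * w 1 + b * w 0) ^ 2 + (a * w 0 + c * w 1) ^ 2 := by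
      rw [hp, hv0, hv1, hS, hq]; ring
    nlinarith [sq_nonneg (d * w 1 + b * w 0), sq_nonneg (a * w 0 + c * w 1)]
  -- the image of `v^⊥`, and its coordinates `α`, `p / q` in the basis `w`, `w^⊥`
  set u0 := b * v 0 - a * v 1 with hu0
  set u1 := d * v 0 - c * v 1 with hu1
  set α := (u0 * w 0 + u1 * w 1) / q with hα
  have hδ : u1 * w 0 - u0 * w 1 = p := by
    rw [hu0, hu1, hw0, hw1, hp]; linear_combination (v 0 ^ 2 + v 1 ^ 2) * hdet
  have hc0 : α * w 0 - p / q * w 1 = u0 := by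
    rw [hα, ← hδ, hq]; rw [hq] at hpw; field_simp; ring
  have hc1 : α * w 1 + p / q * w 0 = u1 := by
    rw [hα, ← hδ, hq]; rw [hq] at hpw; field_simp; ring
  have hαS : |α| ≤ S := by
    have hu : u0 ^ 2 + u1 ^ 2 ≤ S * p := by
      have : S * p - (u0 ^ 2 + u1 ^ 2) = (a * v 0 + b * v 1) ^ 2 + (c * v 0 + d * v 1) ^ 2 := by
        rw [hu0, hu1, hS, hp]; ring
      nlinarith [sq_nonneg (a * v 0 + b * v 1), sq_nonneg (c * v 0 + d * v 1)]
    have hsq : (u0 * w 0 + u1 * w 1) ^ 2 ≤ (S * q) ^ 2 := by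
      calc (u0 * w 0 + u1 * w 1) ^ 2 ≤ (u0 ^ 2 + u1 ^ 2) * q := by
            rw [hq]; nlinarith [sq_nonneg (u0 * w 1 - u1 * w 0)]
        _ ≤ S * (S * q) * q := by gcongr; exact hu.trans (by gcongr)
        _ = (S * q) ^ 2 := by ring
    rw [hα, abs_div, abs_of_pos hpw, div_le_iff₀ hpw]
    exact abs_le_of_sq_le_sq hsq (by positivity)
  refine ⟨-Real.log (p / q), ?_, fun t => ?_⟩
  · rw [abs_neg, abs_le, ← Real.log_inv]
    constructor
    · refine Real.log_le_log (inv_pos.2 hS0) ?_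
      rw [inv_le_comm₀ hS0 (div_pos hpv hpw), inv_div, div_le_iff₀ hpv]
      exact hqp
    · refine Real.log_le_log (div_pos hpv hpw) ?_
      rw [div_le_iff₀ hpw]
      exact hpq
  · have hexp : Real.exp (-(t + -Real.log (p / q))) = Real.exp (-t) * (p / q) := by
      rw [neg_add, neg_neg, Real.exp_add, Real.exp_log (div_pos hpv hpw)]
    have hP : mapGL ℝ g * frame v hv t =
        frame w hgv (t + -Real.log (p / q)) * shear (Real.exp (-t) * α) := by
      refine Units.ext ?_
      rw [Units.val_mul, Units.val_mul, coe_frame, coe_frame, hval, hexp]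
      change _ = _ * !![1, Real.exp (-t) * α; 0, 1]
      rw [Matrix.mul_fin_two, Matrix.mul_fin_two]
      have e00 : a * v 0 + b * v 1 = w 0 * 1 + -(Real.exp (-t) * (p / q) * w 1) * 0 := by
        linear_combination -hw0
      have e01 : a * -(Real.exp (-t) * v 1) + b * (Real.exp (-t) * v 0) =
          w 0 * (Real.exp (-t) * α) + -(Real.exp (-t) * (p / q) * w 1) * 1 := by
        linear_combination (-Real.exp (-t)) * hc0
      have e10 : c * v 0 + d * v 1 = w 1 * 1 + Real.exp (-t) * (p / q) * w 0 * 0 := by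
        linear_combination -hw1
      have e11 : c * -(Real.exp (-t) * v 1) + d * (Real.exp (-t) * v 0) =
          w 1 * (Real.exp (-t) * α) + Real.exp (-t) * (p / q) * w 0 * 1 := by
        linear_combination (-Real.exp (-t)) * hc1
      rw [e00, e01, e10, e11]
    rw [hP]
    refine norm_orbitMeasure_mul_shear_sub_le _ ?_
    rw [abs_mul, abs_of_pos (Real.exp_pos _)]
    gcongr

/-! ### Averaging along a ray -/

/-- The average of the first `M` members of a sequence of probability measures. -/
def ProbSpace.average {Γ : Type*} (M : ℕ) (hM : 0 < M) (μ : ℕ → ProbSpace Γ) : ProbSpace Γ :=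
  ⟨(M : ℝ)⁻¹ • ∑ j ∈ Finset.range M, (μ j).1, fun γ => by
      rw [lp.coeFn_smul, Pi.smul_apply, lp.coeFn_sum, Finset.sum_apply]
      exact smul_nonneg (by positivity) (Finset.sum_nonneg fun j _ => (μ j).2.1 γ), by
    have hM' : (M : ℝ) ≠ 0 := by positivity
    have hn : ‖∑ j ∈ Finset.range M, (μ j).1‖ = M := by
      rw [norm_lp_one]
      calc ∑' γ, |(∑ j ∈ Finset.range M, (μ j).1 : lp (fun _ : Γ => ℝ) 1) γ|
          = ∑' γ, ∑ j ∈ Finset.range M, |(μ j).1 γ| := tsum_congr fun γ => by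
            rw [lp.coeFn_sum, Finset.sum_apply, Finset.abs_sum_of_nonneg fun j _ => (μ j).2.1 γ]
            exact Finset.sum_congr rfl fun j _ => (abs_of_nonneg ((μ j).2.1 γ)).symm
        _ = ∑ j ∈ Finset.range M, ‖(μ j).1‖ := by
            rw [Summable.tsum_finsetSum fun j _ => summable_abs_lp_one (μ j).1]
            exact Finset.sum_congr rfl fun j _ => (norm_lp_one (μ j).1).symm
        _ = M := by
            rw [Finset.sum_congr rfl fun j _ => (μ j).2.2]
            simp
    rw [norm_smul, hn, norm_inv, Real.norm_natCast, inv_mul_cancel₀ hM']⟩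

theorem ProbSpace.smul_average {Γ : Type*} [Group Γ] (M : ℕ) (hM : 0 < M) (μ : ℕ → ProbSpace Γ)
    (g : Γ) : g • ProbSpace.average M hM μ = ProbSpace.average M hM fun j => g • μ j := by
  refine Subtype.ext (lp.ext (funext fun γ => ?_))
  change (average M hM μ).1 (g⁻¹ * γ) = _
  simp only [average, lp.coeFn_smul, Pi.smul_apply, lp.coeFn_sum, Finset.sum_apply]
  rfl

theorem ProbSpace.continuous_average {Γ X : Type*} [TopologicalSpace X] (M : ℕ) (hM : 0 < M)
    {μ : ℕ → X → ProbSpace Γ} (hμ : ∀ j, Continuous (μ j)) :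
    Continuous fun x => ProbSpace.average M hM fun j => μ j x :=
  continuous_induced_rng.2 (Continuous.const_smul (continuous_finsetSum (Finset.range M) fun j _ =>
    continuous_subtype_val.comp (hμ j)) (M : ℝ)⁻¹)

/-- Shifting a window of summation by `m` places exchanges at most `|m|` terms at either end. -/
theorem norm_sum_range_shift_sub_le {E : Type*} [SeminormedAddCommGroup E] (a : ℤ → E)
    (ha : ∀ k, ‖a k‖ ≤ 1) (M : ℕ) (m : ℤ) :
    ‖∑ j ∈ Finset.range M, a (j + m) - ∑ j ∈ Finset.range M, a j‖ ≤ 2 * |(m : ℝ)| := by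
  have step : ∀ m : ℤ,
      ‖∑ j ∈ Finset.range M, a (j + (m + 1)) - ∑ j ∈ Finset.range M, a (j + m)‖ ≤ 2 := by
    intro m
    have h := Finset.sum_range_sub (fun j : ℕ => a (j + m)) M
    rw [← Finset.sum_sub_distrib]
    have e : ∀ j : ℕ, a (j + (m + 1)) - a (j + m) = a ((j + 1 : ℕ) + m) - a (j + m) := fun j => by
      congr 2
      push_cast
      ring
    rw [Finset.sum_congr rfl fun j _ => e j, h]
    calc _ ≤ ‖a (M + m)‖ + ‖a ((0 : ℕ) + m)‖ := norm_sub_le _ _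
      _ ≤ 1 + 1 := add_le_add (ha _) (ha _)
      _ = 2 := by norm_num
  induction m using Int.induction_on with
  | zero => simp
  | succ m ih =>
    have h := (norm_sub_le_norm_sub_add_norm_sub _ _ _).trans (add_le_add (step m) ih)
    refine h.trans ?_
    push_cast
    rw [abs_of_nonneg (by positivity), abs_of_nonneg (by positivity)]
    linarith
  | pred m ih =>
    have hs := step (-m - 1)
    rw [sub_add_cancel, norm_sub_rev] at hs
    have h := (norm_sub_le_norm_sub_add_norm_sub _ _ _).trans (add_le_add hs ih)
    refine h.trans ?_
    push_cast
    rw [abs_neg, abs_of_nonneg (by positivity), abs_of_nonpos (by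
      have : (0 : ℝ) ≤ m := by positivity
      linarith)]
    linarith

/-- If `μ` is termwise close to a shift of `a`, then the averages of `μ` and `a` are close. -/
theorem ProbSpace.norm_average_sub_average_le {Γ : Type*} (M : ℕ) (hM : 0 < M) (m : ℤ)
    (μ : ℕ → ProbSpace Γ) (a : ℤ → ProbSpace Γ) {B : ℝ}
    (h : ∀ j : ℕ, ‖(μ j).1 - (a (j + m)).1‖ ≤ B) :
    ‖(average M hM (fun j => a j)).1 - (average M hM μ).1‖ ≤ B + 2 * |(m : ℝ)| / M := by
  have hM' : (0 : ℝ) < M := by positivity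
  have h1 := norm_sum_range_shift_sub_le (fun k => (a k).1) (fun k => (a k).2.2.le) M m
  have h2 : ‖∑ j ∈ Finset.range M, (μ j).1 - ∑ j ∈ Finset.range M, (a (j + m)).1‖ ≤ M * B := by
    rw [← Finset.sum_sub_distrib]
    refine (norm_sum_le_of_le _ fun j _ => h j).trans ?_
    simp
  have h3 := (norm_sub_le_norm_sub_add_norm_sub _ _ _).trans (add_le_add h2 h1)
  simp only [average]
  rw [← smul_sub, norm_smul, norm_inv, Real.norm_natCast, inv_mul_le_iff₀ hM', norm_sub_rev]
  refine h3.trans (le_of_eq ?_)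
  field_simp

/-- The average of `orbitMeasure` over `n ^ 2` points of the ray in direction `v`, with spacing
`1 / n` and starting at time `n`. -/
def rayMeasure (n : ℕ) (hn : 0 < n) (v : Fin 2 → ℝ) (hv : v ≠ 0) : ProbSpace SL(2, ℤ) :=
  ProbSpace.average (n ^ 2) (pow_pos hn 2) fun j => orbitMeasure (frame v hv (n + j / n))

/-- Approximate equivariance of the averaged measures. The three error terms come from the distance
between the asymptotic rays after time `n`, from rounding the time shift to a multiple of `1 / n`,
and from the terms at the ends of the averaging window. -/
theorem norm_rayMeasure_sub_smul_le (n : ℕ) (hn : 0 < n) (g : SL(2, ℤ)) (v : Fin 2 → ℝ) (hv : v ≠ 0)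
    (hgv : sl2RealMap g v ≠ 0) :
    ‖(rayMeasure n hn (sl2RealMap g v) hgv).1 - (g • rayMeasure n hn v hv).1‖ ≤
      ((1 + Real.exp (-n) * hsNormSq g) ^ 12 - 1) + (Real.exp (1 / n) ^ 12 - 1) +
        2 * (Real.log (hsNormSq g) * n + 1) / (n ^ 2 : ℕ) := by
  obtain ⟨τ, hτ, hray⟩ := exists_norm_orbitMeasure_mapGL_mul_frame_sub_le g v hv hgv
  have hn' : (0 : ℝ) < n := by positivity
  have hS : 0 ≤ hsNormSq g := by unfold hsNormSq; positivity
  have hfl := Int.floor_le (n * τ)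
  have hlt := Int.lt_floor_add_one (n * τ)
  have hnτ : |n * τ| ≤ Real.log (hsNormSq g) * n := by
    rw [abs_mul, abs_of_pos hn', mul_comm]
    gcongr
  have hm : |((⌊n * τ⌋ : ℤ) : ℝ)| ≤ Real.log (hsNormSq g) * n + 1 := by
    have := abs_le.1 hnτ
    rw [abs_le]
    constructor <;> linarith [this.1, this.2]
  simp only [rayMeasure]
  rw [ProbSpace.smul_average]
  refine (ProbSpace.norm_average_sub_average_le (n ^ 2) (pow_pos hn 2) ⌊n * τ⌋ _
    (fun k => orbitMeasure (frame (sl2RealMap g v) hgv (n + k / n))) fun j => ?_).trans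
    (add_le_add le_rfl (by gcongr))
  have h1 := hray (n + j / n)
  -- the shifted time differs from a sample point by less than `1 / n`
  have h2 := norm_orbitMeasure_frame_add_sub_le (sl2RealMap g v) hgv
    (n + ((j + ⌊n * τ⌋ : ℤ) : ℝ) / n) ((n * τ - ⌊n * τ⌋) / n) (div_nonneg (by linarith) hn'.le)
  have e : (n : ℝ) + ((j + ⌊n * τ⌋ : ℤ) : ℝ) / n + (n * τ - ⌊n * τ⌋) / n = n + j / n + τ := by
    push_cast
    field_simp
    ring
  rw [e] at h2
  rw [smul_orbitMeasure]
  refine (norm_sub_le_norm_sub_add_norm_sub _ _ _).trans (add_le_add (h1.trans ?_) (h2.trans ?_))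
  · gcongr
    have : (0 : ℝ) ≤ j / n := by positivity
    linarith
  · gcongr
    linarith

end

theorem mainTheorem2 : IsAmenableAction SL(2, ℤ) HigsonCorona := by
  refine ⟨fun n χ => rayMeasure (n + 1) n.succ_pos χ.direction χ.direction_ne_zero, fun n => ?_,
    fun g => ?_⟩
  · exact ProbSpace.continuous_average _ _ fun j => continuous_orbitMeasure.comp
      (continuous_frame HigsonCorona.continuous_direction HigsonCorona.direction_ne_zero _)
  · let B : ℕ → ℝ := fun n => ((1 + Real.exp (-n) * hsNormSq g) ^ 12 - 1) +
      (Real.exp (1 / n) ^ 12 - 1) + 2 * (Real.log (hsNormSq g) * n + 1) / (n ^ 2 : ℕ)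
    have hbound : ∀ (n : ℕ) (χ : HigsonCorona),
        ‖(rayMeasure (n + 1) n.succ_pos (g • χ).direction (g • χ).direction_ne_zero).1 -
          (g • rayMeasure (n + 1) n.succ_pos χ.direction χ.direction_ne_zero).1‖ ≤ B (n + 1) := by
      intro n χ
      have hgv := sl2RealMap_ne_zero g χ.direction_ne_zero
      have h := norm_rayMeasure_sub_smul_le (n + 1) n.succ_pos g χ.direction χ.direction_ne_zero hgv
      -- `direction (g • χ)` is a positive multiple of `g (direction χ)`, which spans the same ray
      have e : rayMeasure (n + 1) n.succ_pos (g • χ).direction (g • χ).direction_ne_zero =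
          rayMeasure (n + 1) n.succ_pos (sl2RealMap g χ.direction) hgv := by
        have hne := (g • χ).direction_ne_zero
        simp only [(HigsonCorona.norm_direction_and_direction_smul g χ).2] at hne ⊢
        simp only [rayMeasure]
        congr 1
        funext j
        exact orbitMeasure_frame_smul _ hgv (inv_ne_zero (norm_ne_zero_iff.2 hgv)) hne _
      rw [e]
      exact h
    have hB : Tendsto B atTop (𝓝 0) := by
      have t1 : Tendsto (fun n : ℕ => Real.exp (-(n : ℝ))) atTop (𝓝 0) :=
        Real.tendsto_exp_neg_atTop_nhds_zero.comp tendsto_natCast_atTop_atTop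
      have t2 : Tendsto (fun n : ℕ => 1 / (n : ℝ)) atTop (𝓝 0) :=
        tendsto_one_div_atTop_nhds_zero_nat
      have t3 : Tendsto (fun n : ℕ => 2 * (Real.log (hsNormSq g) * n + 1) / (n ^ 2 : ℕ)) atTop
          (𝓝 0) := by
        have h := ((t2.const_mul (Real.log (hsNormSq g))).add (t2.mul t2)).const_mul 2
        rw [mul_zero, mul_zero, add_zero, mul_zero] at h
        refine h.congr' ?_
        filter_upwards [eventually_ne_atTop 0] with n hn
        have : (n : ℝ) ≠ 0 := Nat.cast_ne_zero.2 hn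
        push_cast
        field_simp
      have h1 := (((t1.mul_const (hsNormSq g)).const_add 1).pow 12).sub_const 1
      have h2 := (((Real.continuous_exp.tendsto 0).comp t2).pow 12).sub_const 1
      have h := (h1.add h2).add t3
      simpa [B, Function.comp_def] using h
    refine squeeze_zero (fun n => Real.iSup_nonneg fun χ => norm_nonneg _) (fun n => ?_)
      (tendsto_zero_iff_abs_tendsto_zero _ |>.1 (hB.comp (tendsto_add_atTop_nat 1)))
    exact Real.iSup_le (fun χ => (hbound n χ).trans (le_abs_self _)) (abs_nonneg _)
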